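/- Let $\mathbb T=\{z\in\mathbb C:|z|=1\}$ be the circle group, $\mu_{\mathbb T}$ its Haar measure with $\mu_{\mathbb T}(\mathbb T)=1$, and $L^2(\mathbb T)$ the complex Hilbert space of square integrable functions for $\mu_{\mathbb T}$. For $b\in\mathbb T$ and $f\in L^2(\mathbb T)$ let $\delta_b\ast f$ be the translate $z\mapsto f(b^{-1}z)$. For $b\in\mathbb T$ and $\nu\in\mathbb R$ put $b^{\nu}=e^{it\nu}$, where $t$ is the unique number in $[0,2\pi)$ with $b=e^{it}$. Given $\alpha,\beta\in\mathbb Z$, a (complex) linear form $L:L^2(\mathbb T)\to\mathbb C$, not assumed continuous, is called $(\alpha,\beta)$-invariant if, for all $b\in\mathbb T$ and $f\in L^2(\mathbb T)$, \[L\left[b^{(\alpha+\beta)/2}\,\delta_b\ast f+b^{-(\alpha+\beta)/2}\,\delta_{b^{-1}}\ast f\right]=\bigl(b^{(\alpha-\beta)/2}+b^{-(\alpha-\beta)/2}\bigr)L(f),\] and translation invariant if $L(\delta_b\ast f)=L(f)$ for all $b\in\mathbb T$ and $f\in L^2(\mathbb T)$. Theorem. Let $\alpha,\beta\in\mathbb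 Z$ and let $L$ be a linear form on $L^2(\mathbb T)$. Then the following hold. (i) If $L$ is $(\alpha,\beta)$-invariant, then $L$ is continuous on $L^2(\mathbb T)$; thus there is $h\in L^2(\mathbb T)$ such that $L(f)=\int_{\mathbb T}f\,\overline h\,d\mu_{\mathbb T}$ for all $f\in L^2(\mathbb T)$. (ii) If $h\in L^2(\mathbb T)$, the linear form $f\mapsto\int_{\mathbb T}f\,\overline h\,d\mu_{\mathbb T}$ on $L^2(\mathbb T)$ is $(\alpha,\beta)$-invariant if and only if there are $c_1,c_2\in\mathbb C$ such that $h(z)=c_1z^{\alpha}+c_2z^{\beta}$ for almost all $z\in\mathbb T$. (iii) If $L$ is translation invariant, then $L$ is a multiple of the Haar measure: there is $c\in\mathbb C$ such that $L(f)=c\int_{\mathbb T}f\,d\mu_{\mathbb T}$ for all $f\in L^2(\mathbb T)$. -/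

import Mathlib

open MeasureTheory
open scoped ComplexConjugate

namespace CircleGroup

/-- The circle group carries its Borel σ-algebra. -/
noncomputable instance instMeasurableSpaceCircle : MeasurableSpace Circle := borel Circle

instance instBorelSpaceCircle : BorelSpace Circle := ⟨rfl⟩

/-- The Haar measure on the circle group, normalised to have total mass `1`. -/
noncomputable def haar : Measure Circle := Measure.haarMeasure ⊤

instance instIsHaarMeasureHaar : haar.IsHaarMeasure :=
  inferInstanceAs (Measure.haarMeasure (⊤ : TopologicalSpace.PositiveCompacts Circle)).IsHaarMeasure

instance instIsProbabilityMeasureHaar : IsProbabilityMeasure haar :=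
  ⟨Measure.haarMeasure_self⟩

/-- The complex Hilbert space `L²(𝕋)`. -/
abbrev L2 : Type := Lp ℂ 2 haar

/-- The unique `t ∈ [0, 2π)` with `z = exp (i t)`. -/
noncomputable def angle (z : Circle) : ℝ :=
  toIcoMod Real.two_pi_pos 0 (Complex.arg (z : ℂ))

theorem angle_mem (z : Circle) : angle z ∈ Set.Ico 0 (2 * Real.pi) := by
  simpa [angle] using toIcoMod_mem_Ico Real.two_pi_pos 0 (Complex.arg (z : ℂ))

theorem exp_angle (z : Circle) : Circle.exp (angle z) = z := by
  rw [angle, toIcoMod, Circle.exp_sub]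
  simp [Circle.exp_arg]

/-- The power `z ^ ν = exp (i t ν)`, where `z = exp (i t)` with `t ∈ [0, 2π)`. -/
noncomputable def branchPow (z : Circle) (ν : ℝ) : ℂ :=
  Complex.exp (Complex.I * (angle z : ℂ) * (ν : ℂ))

/-- The convolution `δ_b ∗ f`, that is, the translate `z ↦ f (b⁻¹ z)` of `f ∈ L²(𝕋)`. -/
noncomputable def diracConv (b : Circle) (f : L2) : L2 :=
  Lp.compMeasurePreserving (fun z : Circle => b⁻¹ * z) (measurePreserving_mul_left haar b⁻¹) f

/-- `L` is `(α, β)`-invariant: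
`L [(b^((α+β)/2) δ_b + b^(-(α+β)/2) δ_{b⁻¹}) ∗ f] = (b^((α-β)/2) + b^(-(α-β)/2)) L f`
for all `b ∈ 𝕋` and `f ∈ L²(𝕋)`. -/
def IsInvariant (α β : ℤ) (L : L2 →ₗ[ℂ] ℂ) : Prop :=
  ∀ (b : Circle) (f : L2),
    L (branchPow b (((α : ℝ) + β) / 2) • diracConv b f
        + branchPow b (-(((α : ℝ) + β) / 2)) • diracConv b⁻¹ f)
      = (branchPow b (((α : ℝ) - β) / 2) + branchPow b (-(((α : ℝ) - β) / 2))) * L f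

/-- `L` is translation invariant: `L (δ_b ∗ f) = L f` for all `b ∈ 𝕋` and `f ∈ L²(𝕋)`. -/
def IsTranslationInvariant (L : L2 →ₗ[ℂ] ℂ) : Prop :=
  ∀ (b : Circle) (f : L2), L (diracConv b f) = L f

theorem integral_mul_conj_eq_inner (h f : L2) :
    ∫ z, f z * conj (h z) ∂haar = inner ℂ h f := by
  simp [L2.inner_def, RCLike.inner_apply]

/-- The linear form `f ↦ ∫ f h̄` on `L²(𝕋)` given by `h ∈ L²(𝕋)`. -/
noncomputable def integralForm (h : L2) : L2 →ₗ[ℂ] ℂ where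
  toFun f := ∫ z, f z * conj (h z) ∂haar
  map_add' f g := by
    simp only [integral_mul_conj_eq_inner, inner_add_right]
  map_smul' c f := by
    simp only [integral_mul_conj_eq_inner, inner_smul_right, RingHom.id_apply, smul_eq_mul]

end CircleGroup

/-!
Dividing the invariance relation by `b ^ ((α + β) / 2)`, it says that `L` vanishes on the range of
an operator `T_b` that multiplies the `n`-th Fourier coefficient by
`m_b(n) = b⁻ⁿ (1 - bⁿ⁻ᵅ) (1 - bⁿ⁻ᵝ)`. A function `f` is of the form `T_{b₁} g₁ + ⋯ + T_{b₈} g₈` as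
soon as `∑ₙ |f̂(n)|² / ∑ⱼ |m_{bⱼ}(n)|²` is finite. The denominator is at least
`∏ⱼ |m_{bⱼ}(n)| ^ (1 / 4)`, and `∫ |m_b(n)| ^ (-1 / 4) db ≤ ∫ |1 - z| ^ (-1 / 2) dz < ∞` for every
`n ≠ α, β`, because `b ↦ bˡ` preserves Haar measure for `l ≠ 0`. Hence, if `f̂(α) = f̂(β) = 0`, the
sum is finite for almost every choice of `b₁, …, b₈`, and `L f = 0`. So `L f` depends only on
`f̂(α)` and `f̂(β)`. A translation invariant form is `(0, 0)`-invariant, so it is a multiple of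
`f̂(0)`.
-/

section MultiplierEquations

open scoped ENNReal

theorem memℓp_two_iff_tsum_enorm_sq_ne_top {ι : Type*} {E : ι → Type*}
    [∀ i, NormedAddCommGroup (E i)] {f : ∀ i, E i} :
    Memℓp f 2 ↔ ∑' i, ‖f i‖ₑ ^ 2 ≠ ∞ := by
  rw [memℓp_gen_iff (by simp)]
  simp only [enorm_eq_nnnorm, ← ENNReal.coe_pow, ENNReal.tsum_coe_ne_top_iff_summable_coe]
  simp

section NegativeMoments

variable {ι Ω : Type*} [Countable ι] [MeasurableSpace Ω] {μ : Measure Ω} [NeZero μ]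
  {w : Ω → ι → ℝ≥0∞} {a : ι → ℝ≥0∞} {K : ℝ≥0∞}

theorem exists_tsum_mul_ne_top (hw : ∀ i, Measurable fun ω => w ω i) (ha : ∑' i, a i ≠ ∞)
    (hK : K ≠ ∞) (hwK : ∀ i, a i ≠ 0 → ∫⁻ ω, w ω i ∂μ ≤ K) :
    ∃ ω, ∑' i, a i * w ω i ≠ ∞ := by
  have h_bound : ∫⁻ ω, ∑' i, a i * w ω i ∂μ ≤ (∑' i, a i) * K := by
    rw [lintegral_tsum fun i => ((hw i).const_mul _).aemeasurable, ← ENNReal.tsum_mul_right]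
    refine ENNReal.tsum_le_tsum fun i => ?_
    rw [lintegral_const_mul _ (hw i)]
    rcases eq_or_ne (a i) 0 with hi | hi
    · simp [hi]
    · exact mul_le_mul_right (hwK i hi) _
  have h_ae := ae_lt_top (Measurable.tsum fun i => (hw i).const_mul (a i))
    (ne_top_of_le_ne_top (ENNReal.mul_ne_top ha hK) h_bound)
  exact h_ae.exists.imp fun _ => LT.lt.ne

theorem exists_tsum_mul_prod_ne_top (hw : ∀ i, Measurable fun ω => w ω i) (ha : ∑' i, a i ≠ ∞)
    (hK : K ≠ ∞) (hwK : ∀ i, a i ≠ 0 → ∫⁻ ω, w ω i ∂μ ≤ K) (k : ℕ) :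
    ∃ ω : Fin k → Ω, ∑' i, a i * ∏ j, w (ω j) i ≠ ∞ := by
  induction k with
  | zero => exact ⟨Fin.elim0, by simpa using ha⟩
  | succ k ih =>
    obtain ⟨ω, hω⟩ := ih
    obtain ⟨ω', hω'⟩ :=
      exists_tsum_mul_ne_top hw hω hK fun i hi => hwK i (left_ne_zero_of_mul hi)
    exact ⟨Fin.snoc ω ω', by simpa [Fin.prod_univ_castSucc, mul_assoc] using hω'⟩

end NegativeMoments

theorem inv_sum_sq_le_prod_rpow {k : ℕ} (hk : k ≠ 0) (x : Fin k → ℝ≥0∞) :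
    (∑ j, x j ^ 2)⁻¹ ≤ ∏ j, x j ^ (-(2 / k) : ℝ) := by
  have hk' : (k : ℝ) ≠ 0 := Nat.cast_ne_zero.2 hk
  calc (∑ j, x j ^ 2)⁻¹
      = ∏ _j : Fin k, ((∑ j, x j ^ 2) ^ (1 / k : ℝ))⁻¹ := by
        rw [Finset.prod_const, Finset.card_fin, ← ENNReal.inv_pow, ← ENNReal.rpow_mul_natCast,
          one_div_mul_cancel hk', ENNReal.rpow_one]
    _ ≤ ∏ j, ((x j ^ 2) ^ (1 / k : ℝ))⁻¹ := by
        gcongr with j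
        exact Finset.single_le_sum (f := fun j => x j ^ 2) (fun _ _ => zero_le) (Finset.mem_univ j)
    _ = ∏ j, x j ^ (-(2 / k) : ℝ) := by
        refine Finset.prod_congr rfl fun j _ => ?_
        rw [← ENNReal.rpow_natCast, ← ENNReal.rpow_mul, ENNReal.rpow_neg]
        congr 2
        push_cast
        ring

-- Since `0⁻¹ = ∞` and `0 * ∞ = 0` in `ℝ≥0∞`, the hypothesis says that `c = 0` if all `m j` vanish.
theorem exists_sum_mul_eq_of_enorm_sq_mul_inv_ne_top {𝕜 J : Type*} [RCLike 𝕜] [Fintype J]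
    {c : 𝕜} {m : J → 𝕜} (h : ‖c‖ₑ ^ 2 * (∑ j, ‖m j‖ₑ ^ 2)⁻¹ ≠ ∞) :
    ∃ y : J → 𝕜, ∑ j, m j * y j = c ∧
      ∀ j, ‖y j‖ₑ ^ 2 ≤ ‖c‖ₑ ^ 2 * (∑ j, ‖m j‖ₑ ^ 2)⁻¹ := by
  rcases eq_or_ne c 0 with rfl | hc
  · exact ⟨0, by simp⟩
  set S : ℝ := ∑ j, ‖m j‖ ^ 2 with hS
  have hS_enorm : ∑ j, ‖m j‖ₑ ^ 2 = ENNReal.ofReal S := by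
    simp [hS, ENNReal.ofReal_sum_of_nonneg, ENNReal.ofReal_pow]
  rw [hS_enorm] at h ⊢
  have hS_pos : 0 < S := by
    by_contra! hS_nonpos
    simp [ENNReal.ofReal_of_nonpos hS_nonpos, hc, ENNReal.mul_top] at h
  refine ⟨fun j => c * conj (m j) / S, ?_, fun j => ?_⟩
  · have hS_ne : (S : 𝕜) ≠ 0 := RCLike.ofReal_ne_zero.2 hS_pos.ne'
    have hS_sum : ∑ j, m j * conj (m j) = (S : 𝕜) := by simp [hS, RCLike.mul_conj]
    calc ∑ j, m j * (c * conj (m j) / S)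
        = (∑ j, m j * conj (m j)) * (c / S) := by
          rw [Finset.sum_mul]
          exact Finset.sum_congr rfl fun j _ => by ring
      _ = c := by rw [hS_sum, mul_div_cancel₀ _ hS_ne]
  · have hm_le : ‖m j‖ ^ 2 ≤ S :=
      Finset.single_le_sum (f := fun j => ‖m j‖ ^ 2) (fun _ _ => sq_nonneg _) (Finset.mem_univ j)
    have h_norm : ‖c * conj (m j) / S‖ ^ 2 ≤ ‖c‖ ^ 2 * S⁻¹ := by
      rw [norm_div, norm_mul, RCLike.norm_conj, RCLike.norm_ofReal, abs_of_pos hS_pos]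
      calc (‖c‖ * ‖m j‖ / S) ^ 2 = ‖c‖ ^ 2 * ‖m j‖ ^ 2 / S ^ 2 := by ring
        _ ≤ ‖c‖ ^ 2 * S / S ^ 2 := by gcongr
        _ = ‖c‖ ^ 2 * S⁻¹ := by field_simp
    rw [← ofReal_norm, ← ofReal_norm, ← ENNReal.ofReal_inv_of_pos hS_pos,
      ← ENNReal.ofReal_pow (norm_nonneg _), ← ENNReal.ofReal_pow (norm_nonneg _),
      ← ENNReal.ofReal_mul (by positivity)]
    exact ENNReal.ofReal_le_ofReal h_norm

variable {ι 𝕜 E : Type*} [RCLike 𝕜] [NormedAddCommGroup E] [InnerProductSpace 𝕜 E]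

/-- The map `T` acts diagonally on the coordinates of a Hilbert basis `e`: it multiplies the
`i`-th coordinate by `m i`. Neither linearity nor continuity of `T` is part of the notion. -/
def ActsDiagonally (e : HilbertBasis ι 𝕜 E) (m : ι → 𝕜) (T : E → E) : Prop :=
  ∀ x i, e.repr (T x) i = m i * e.repr x i

namespace ActsDiagonally

variable {e : HilbertBasis ι 𝕜 E}

theorem exists_sum_eq_of_tsum_ne_top {J : Type*} [Fintype J] {m : J → ι → 𝕜} {T : J → E → E}
    (hT : ∀ j, ActsDiagonally e (m j) (T j)) {x : E}
    (hx : ∑' i, ‖e.repr x i‖ₑ ^ 2 * (∑ j, ‖m j i‖ₑ ^ 2)⁻¹ ≠ ∞) :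
    ∃ g : J → E, ∑ j, T j (g j) = x := by
  choose y hy_sum hy_le using fun i =>
    exists_sum_mul_eq_of_enorm_sq_mul_inv_ne_top (ENNReal.ne_top_of_tsum_ne_top hx i)
  have hy_mem (j : J) : Memℓp (fun i => y i j) 2 :=
    memℓp_two_iff_tsum_enorm_sq_ne_top.2 <|
      ne_top_of_le_ne_top hx (ENNReal.tsum_le_tsum fun i => hy_le i j)
  refine ⟨fun j => e.repr.symm ⟨_, hy_mem j⟩, e.repr.injective ?_⟩
  ext i
  calc e.repr (∑ j, T j (e.repr.symm ⟨_, hy_mem j⟩)) i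
      = ∑ j, e.repr (T j (e.repr.symm ⟨_, hy_mem j⟩)) i := by
        simp only [HilbertBasis.repr_apply_apply, inner_sum]
    _ = e.repr x i := by simp only [hT _ _ i, LinearIsometryEquiv.apply_symm_apply, hy_sum i]

variable {Ω : Type*} [MeasurableSpace Ω] {μ : Measure Ω} [NeZero μ] [Countable ι]
  {m : Ω → ι → 𝕜} {T : Ω → E → E}

theorem exists_sum_eq_of_lintegral_rpow_le (hT : ∀ ω, ActsDiagonally e (m ω) (T ω))
    (hm : ∀ i, Measurable fun ω => m ω i) {k : ℕ} (hk : k ≠ 0) {K : ℝ≥0∞} (hK : K ≠ ∞) {x : E}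
    (hmK : ∀ i, e.repr x i ≠ 0 → ∫⁻ ω, ‖m ω i‖ₑ ^ (-(2 / k) : ℝ) ∂μ ≤ K) :
    ∃ (ω : Fin k → Ω) (g : Fin k → E), ∑ j, T (ω j) (g j) = x := by
  obtain ⟨ω, hω⟩ := exists_tsum_mul_prod_ne_top (μ := μ)
    (fun i => (hm i).enorm.pow_const (-(2 / k) : ℝ))
    (memℓp_two_iff_tsum_enorm_sq_ne_top.1 (lp.memℓp (e.repr x))) hK
    (fun i hi => hmK i (by simpa using hi)) k
  refine ⟨ω, exists_sum_eq_of_tsum_ne_top (fun j => hT (ω j)) (ne_top_of_le_ne_top hω ?_)⟩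
  gcongr with i
  exact inv_sum_sq_le_prod_rpow hk fun j => ‖m (ω j) i‖ₑ

theorem map_eq_sum_repr_smul {F : Type*} [AddCommGroup F] [Module 𝕜 F]
    (hT : ∀ ω, ActsDiagonally e (m ω) (T ω)) (hm : ∀ i, Measurable fun ω => m ω i) {k : ℕ}
    (hk : k ≠ 0) {K : ℝ≥0∞} (hK : K ≠ ∞) {s : Finset ι}
    (hmK : ∀ i ∉ s, ∫⁻ ω, ‖m ω i‖ₑ ^ (-(2 / k) : ℝ) ∂μ ≤ K) {L : E →ₗ[𝕜] F}
    (hL : ∀ ω x, L (T ω x) = 0) (x : E) :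
    L x = ∑ i ∈ s, e.repr x i • L (e i) := by
  have h_repr (i : ι) (hi : i ∈ s) : e.repr (x - ∑ i ∈ s, e.repr x i • e i) i = 0 := by
    rw [HilbertBasis.repr_apply_apply, inner_sub_right, e.orthonormal.inner_right_sum _ hi,
      HilbertBasis.repr_apply_apply, sub_self]
  obtain ⟨ω, g, hg⟩ := exists_sum_eq_of_lintegral_rpow_le hT hm hk hK
    fun i hi => hmK i fun his => hi (h_repr i his)
  have h_zero : L (x - ∑ i ∈ s, e.repr x i • e i) = 0 := by simp [← hg, hL]
  simpa [sub_eq_zero] using h_zero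

end ActsDiagonally

end MultiplierEquations

namespace CircleGroup

section HilbertBasis

theorem measurePreserving_toCircle {T : ℝ} [hT : Fact (0 < T)] :
    MeasurePreserving (AddCircle.toCircle (T := T)) AddCircle.haarAddCircle haar := by
  have h_meas : Measurable (AddCircle.toCircle (T := T)) := AddCircle.continuous_toCircle.measurable
  refine ⟨h_meas, ?_⟩
  set μ := (AddCircle.haarAddCircle (T := T)).map AddCircle.toCircle
  have : IsProbabilityMeasure μ := Measure.isProbabilityMeasure_map h_meas.aemeasurable
  have : μ.IsMulLeftInvariant := by
    refine ⟨fun z => ?_⟩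
    obtain ⟨y, rfl⟩ := (AddCircle.homeomorphCircle hT.out.ne').surjective z
    have h_comp : (AddCircle.homeomorphCircle hT.out.ne' y * ·) ∘ AddCircle.toCircle
        = AddCircle.toCircle ∘ (y + ·) := by
      ext x
      simp [AddCircle.homeomorphCircle_apply, AddCircle.toCircle_add]
    rw [Measure.map_map (measurable_const_mul _) h_meas, h_comp,
      ← Measure.map_map h_meas (measurable_const_add _), map_add_left_eq_self]
  simpa [haar] using Measure.haarMeasure_unique μ ⊤

/-- The character `z ↦ z ^ n` of the circle, as a continuous function. -/
noncomputable def monomial (n : ℤ) : C(Circle, ℂ) where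
  toFun z := (z : ℂ) ^ n
  continuous_toFun := continuous_subtype_val.zpow₀ n fun z => .inl (Circle.coe_ne_zero z)

/-- The character `z ↦ z ^ n` of the circle, as an element of `L²(𝕋)`. -/
noncomputable def monomialLp (n : ℤ) : L2 := ContinuousMap.toLp 2 haar ℂ (monomial n)

theorem coeFn_monomialLp (n : ℤ) : monomialLp n =ᵐ[haar] fun z => (z : ℂ) ^ n :=
  ContinuousMap.coeFn_toLp haar (monomial n)

/-- The pullback `f ↦ f ∘ toCircle` of square integrable functions to `ℝ / ℤ`. -/
noncomputable def toAddCircle : L2 →ₗᵢ[ℂ] Lp ℂ 2 (AddCircle.haarAddCircle (T := 1)) :=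
  Lp.compMeasurePreservingₗᵢ ℂ AddCircle.toCircle measurePreserving_toCircle

theorem toAddCircle_monomialLp (n : ℤ) : toAddCircle (monomialLp n) = fourierLp 2 n := by
  refine Lp.ext ?_
  filter_upwards [Lp.coeFn_compMeasurePreserving (monomialLp n) measurePreserving_toCircle,
    measurePreserving_toCircle.quasiMeasurePreserving.ae (coeFn_monomialLp n),
    coeFn_fourierLp 2 n] with x h_comp h_monomial h_fourier
  rw [h_fourier, fourier_apply, AddCircle.toCircle_zsmul, Circle.coe_zpow, ← h_monomial]
  exact h_comp

theorem orthonormal_monomialLp : Orthonormal ℂ monomialLp := by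
  rw [← toAddCircle.orthonormal_comp_iff]
  convert orthonormal_fourier (T := 1) using 1
  exact funext toAddCircle_monomialLp

theorem eq_zero_of_forall_inner_monomialLp_eq_zero {f : L2}
    (hf : ∀ n, inner ℂ (monomialLp n) f = 0) : f = 0 := by
  refine toAddCircle.injective (fourierBasis.repr.injective ?_)
  ext n
  rw [HilbertBasis.repr_apply_apply, coe_fourierBasis, ← toAddCircle_monomialLp,
    LinearIsometry.inner_map_map, hf]
  simp

/-- The Hilbert basis `(z ^ n)` of `L²(𝕋)`, indexed by `n : ℤ`. -/
noncomputable def monomialBasis : HilbertBasis ℤ ℂ L2 :=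
  HilbertBasis.mkOfOrthogonalEqBot orthonormal_monomialLp <|
    (Submodule.eq_bot_iff _).2 fun _ hf => eq_zero_of_forall_inner_monomialLp_eq_zero fun n =>
      hf _ (Submodule.subset_span ⟨n, rfl⟩)

theorem coe_monomialBasis : ⇑monomialBasis = monomialLp :=
  HilbertBasis.coe_mkOfOrthogonalEqBot _ _

theorem monomialBasis_repr (f : L2) (n : ℤ) :
    monomialBasis.repr f n = ∫ z, f z * (z : ℂ) ^ (-n) ∂haar := by
  rw [HilbertBasis.repr_apply_apply, coe_monomialBasis, ← integral_mul_conj_eq_inner]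
  refine integral_congr_ae ?_
  filter_upwards [coeFn_monomialLp n] with z hz
  rw [hz, map_zpow₀, ← Circle.coe_inv_eq_conj, Circle.coe_inv, inv_zpow']

theorem actsDiagonally_diracConv (b : Circle) :
    ActsDiagonally monomialBasis (fun n => (b : ℂ) ^ (-n)) (diracConv b) := by
  intro f n
  have h_conv : ∀ᵐ z ∂haar, diracConv b f z = f (b⁻¹ * z) :=
    Lp.coeFn_compMeasurePreserving f (measurePreserving_mul_left haar b⁻¹)
  calc monomialBasis.repr (diracConv b f) n
      = ∫ z, (b : ℂ) ^ (-n) * (f (b⁻¹ * z) * ((b⁻¹ * z : Circle) : ℂ) ^ (-n)) ∂haar := by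
        rw [monomialBasis_repr]
        refine integral_congr_ae ?_
        filter_upwards [h_conv] with z hz
        have hb : (b : ℂ) ≠ 0 := b.coe_ne_zero
        rw [hz, Circle.coe_mul, mul_zpow, Circle.coe_inv, inv_zpow]
        field_simp
    _ = (b : ℂ) ^ (-n) * monomialBasis.repr f n := by
        rw [integral_mul_left_eq_self fun z : Circle => (b : ℂ) ^ (-n) * (f z * (z : ℂ) ^ (-n)),
          integral_const_mul, monomialBasis_repr]

end HilbertBasis

section SingularIntegral

theorem four_mul_abs_le_norm_one_sub_toCircle {x : ℝ} (hx : x ∈ Set.Ioc (-(1 / 2)) (1 / 2)) :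
    4 * |x| ≤ ‖1 - (AddCircle.toCircle (x : UnitAddCircle) : ℂ)‖ := by
  have hπ := Real.pi_pos
  have h_arg : Complex.arg (AddCircle.toCircle (x : UnitAddCircle)) = 2 * Real.pi * x := by
    rw [AddCircle.toCircle_apply_mk, div_one, Circle.arg_exp] <;> nlinarith [hx.1, hx.2]
  calc 4 * |x| = 2 / Real.pi * |2 * Real.pi * x| := by
        rw [abs_mul, abs_of_pos Real.two_pi_pos]
        field_simp
        ring
    _ ≤ ‖1 - (AddCircle.toCircle (x : UnitAddCircle) : ℂ)‖ := by
        rw [← h_arg, ← Complex.angle_one_left (Circle.coe_ne_zero _)]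
        exact Complex.mul_angle_le_norm_sub norm_one (Circle.norm_coe _)

theorem setLIntegral_Ioc_enorm_rpow_lt_top {r a b : ℝ} (hr : -1 < r) :
    ∫⁻ x in Set.Ioc a b, ‖x‖ₑ ^ r < ⊤ := by
  have h_int : IntegrableOn (fun x : ℝ => (x : ℂ) ^ (r : ℂ)) (Set.Ioc a b) :=
    (intervalIntegral.intervalIntegrable_cpow' hr).1
  refine (lintegral_congr_ae (ae_restrict_of_ae ?_)).trans_lt h_int.2
  filter_upwards [Measure.ae_ne volume (0 : ℝ)] with x hx
  rw [← ofReal_norm, ← ofReal_norm, Complex.norm_cpow_real, Complex.norm_real,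
    ENNReal.ofReal_rpow_of_pos (norm_pos_iff.2 hx)]

theorem lintegral_enorm_one_sub_rpow_neg_lt_top {s : ℝ} (hs₀ : 0 ≤ s) (hs₁ : s < 1) :
    ∫⁻ z : Circle, ‖1 - (z : ℂ)‖ₑ ^ (-s) ∂haar < ⊤ := by
  have h_meas : Measurable fun z : Circle => ‖1 - (z : ℂ)‖ₑ ^ (-s) :=
    (by fun_prop : Continuous fun z : Circle => ‖1 - (z : ℂ)‖ₑ).measurable.pow_const _
  have h_haar : AddCircle.haarAddCircle (T := 1) = volume := by
    simp [AddCircle.volume_eq_smul_haarAddCircle]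
  rw [← (measurePreserving_toCircle (T := 1)).lintegral_comp h_meas, h_haar,
    ← UnitAddCircle.lintegral_preimage (-(1 / 2))]
  refine lt_of_le_of_lt (setLIntegral_mono' measurableSet_Ioc fun x hx => ?_)
    (setLIntegral_Ioc_enorm_rpow_lt_top (by linarith : -1 < -s))
  have h_le : |x| ≤ ‖1 - (AddCircle.toCircle (x : UnitAddCircle) : ℂ)‖ := by
    have := four_mul_abs_le_norm_one_sub_toCircle (x := x) ⟨hx.1, by linarith [hx.2]⟩
    linarith [abs_nonneg x]
  rw [ENNReal.rpow_neg, ENNReal.rpow_neg]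
  gcongr
  exact enorm_le_iff_norm_le.2 h_le

theorem zpow_surjective {n : ℤ} (hn : n ≠ 0) : Function.Surjective fun z : Circle => z ^ n := by
  intro z
  refine ⟨Circle.exp (angle z / n), ?_⟩
  simp only [← Circle.exp_zsmul, zsmul_eq_mul]
  rw [mul_div_cancel₀ _ (Int.cast_ne_zero.2 hn), exp_angle]

theorem measurePreserving_zpow {n : ℤ} (hn : n ≠ 0) :
    MeasurePreserving (fun z : Circle => z ^ n) haar haar :=
  (zpowGroupHom n : Circle →* Circle).measurePreserving (continuous_zpow n) (zpow_surjective hn) rfl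

theorem lintegral_enorm_one_sub_zpow_rpow {n : ℤ} (hn : n ≠ 0) (r : ℝ) :
    ∫⁻ z : Circle, ‖1 - (z : ℂ) ^ n‖ₑ ^ r ∂haar = ∫⁻ z : Circle, ‖1 - (z : ℂ)‖ₑ ^ r ∂haar := by
  have h_meas : Measurable fun z : Circle => ‖1 - (z : ℂ)‖ₑ ^ r :=
    (by fun_prop : Continuous fun z : Circle => ‖1 - (z : ℂ)‖ₑ).measurable.pow_const _
  simpa using (measurePreserving_zpow hn).lintegral_comp h_meas

end SingularIntegral

section SecondDifferences

theorem branchPow_add_intCast (b : Circle) (ν : ℝ) (n : ℤ) :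
    branchPow b (ν + n) = branchPow b ν * (b : ℂ) ^ n := by
  have hb : (b : ℂ) = Complex.exp (angle b * Complex.I) := by
    rw [← Circle.coe_exp, exp_angle]
  rw [branchPow, branchPow, hb, ← Complex.exp_int_mul, ← Complex.exp_add]
  push_cast
  ring_nf

/-- The operator `δ_b + b ^ (-(α + β)) δ_{b⁻¹} - (b ^ (-α) + b ^ (-β))`. Dividing the
`(α, β)`-invariance relation by `b ^ ((α + β) / 2)` says that the linear form vanishes on its
range, and only integral powers of `b` remain. -/
noncomputable def secondDifference (α β : ℤ) (b : Circle) (f : L2) : L2 :=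
  diracConv b f + (b : ℂ) ^ (-(α + β)) • diracConv b⁻¹ f - ((b : ℂ) ^ (-α) + (b : ℂ) ^ (-β)) • f

theorem isInvariant_iff_forall_secondDifference {α β : ℤ} {L : L2 →ₗ[ℂ] ℂ} :
    IsInvariant α β L ↔ ∀ b f, L (secondDifference α β b f) = 0 := by
  refine forall₂_congr fun b f => ?_
  set p := branchPow b (((α : ℝ) + β) / 2)
  have hp_ne : p ≠ 0 := Complex.exp_ne_zero _
  have h_shift {ν : ℝ} (n : ℤ) (hν : ν = ((α : ℝ) + β) / 2 + n) :
      branchPow b ν = p * (b : ℂ) ^ n := by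
    rw [hν, branchPow_add_intCast]
  rw [h_shift (ν := -(((α : ℝ) + β) / 2)) (-(α + β)) (by push_cast; ring),
    h_shift (ν := ((α : ℝ) - β) / 2) (-β) (by push_cast; ring),
    h_shift (ν := -(((α : ℝ) - β) / 2)) (-α) (by push_cast; ring),
    ← sub_eq_zero, ← mul_eq_zero_iff_left (b := L _) hp_ne]
  simp only [secondDifference, map_add, map_sub, map_smul, smul_eq_mul]
  ring_nf

/-- The Fourier multiplier of `secondDifference α β b`. -/
noncomputable def symbol (α β : ℤ) (b : Circle) (n : ℤ) : ℂ :=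
  (b : ℂ) ^ (-n) * ((1 - (b : ℂ) ^ (n - α)) * (1 - (b : ℂ) ^ (n - β)))

theorem actsDiagonally_secondDifference (α β : ℤ) (b : Circle) :
    ActsDiagonally monomialBasis (symbol α β b) (secondDifference α β b) := by
  intro f n
  have hb : (b : ℂ) ≠ 0 := b.coe_ne_zero
  simp only [secondDifference, symbol, map_sub, map_add, map_smul, lp.coeFn_sub, lp.coeFn_add,
    lp.coeFn_smul, Pi.sub_apply, Pi.add_apply, Pi.smul_apply, smul_eq_mul,
    actsDiagonally_diracConv _ f n, Circle.coe_inv, inv_zpow', zpow_sub₀ hb, zpow_neg,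
    zpow_add₀ hb]
  field_simp
  ring

theorem measurable_symbol (α β n : ℤ) : Measurable fun b => symbol α β b n :=
  ((monomial _).continuous.mul ((continuous_const.sub (monomial _).continuous).mul
    (continuous_const.sub (monomial _).continuous))).measurable

theorem enorm_symbol (α β : ℤ) (b : Circle) (n : ℤ) :
    ‖symbol α β b n‖ₑ = ‖1 - (b : ℂ) ^ (n - α)‖ₑ * ‖1 - (b : ℂ) ^ (n - β)‖ₑ := by
  have hb : ‖(b : ℂ) ^ (-n)‖ₑ = 1 := by
    rw [← ofReal_norm, norm_zpow, Circle.norm_coe, one_zpow, ENNReal.ofReal_one]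
  rw [symbol, enorm_mul, enorm_mul, hb, one_mul]

theorem lintegral_enorm_symbol_rpow_le {α β n : ℤ} (hα : n ≠ α) (hβ : n ≠ β) (r : ℝ) :
    ∫⁻ b, ‖symbol α β b n‖ₑ ^ r ∂haar ≤ ∫⁻ z : Circle, ‖1 - (z : ℂ)‖ₑ ^ (2 * r) ∂haar := by
  set M := ∫⁻ z : Circle, ‖1 - (z : ℂ)‖ₑ ^ (2 * r) ∂haar
  have h_meas (l : ℤ) : AEMeasurable (fun b : Circle => ‖1 - (b : ℂ) ^ l‖ₑ ^ r) haar :=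
    ((continuous_const.sub (monomial l).continuous).enorm.measurable.pow_const _).aemeasurable
  have h_sq {l : ℤ} (hl : l ≠ 0) :
      ∫⁻ b : Circle, (‖1 - (b : ℂ) ^ l‖ₑ ^ r) ^ (2 : ℝ) ∂haar = M := by
    simp only [← ENNReal.rpow_mul, mul_comm r]
    exact lintegral_enorm_one_sub_zpow_rpow hl _
  calc ∫⁻ b, ‖symbol α β b n‖ₑ ^ r ∂haar
      = ∫⁻ b : Circle, ‖1 - (b : ℂ) ^ (n - α)‖ₑ ^ r * ‖1 - (b : ℂ) ^ (n - β)‖ₑ ^ r ∂haar := by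
        simp only [enorm_symbol, ENNReal.mul_rpow_of_ne_top enorm_ne_top enorm_ne_top]
    _ ≤ M ^ (1 / 2 : ℝ) * M ^ (1 / 2 : ℝ) := by
        have h_holder := ENNReal.lintegral_mul_le_Lp_mul_Lq haar Real.HolderConjugate.two_two
          (h_meas (n - α)) (h_meas (n - β))
        rwa [h_sq (sub_ne_zero.2 hα), h_sq (sub_ne_zero.2 hβ)] at h_holder
    _ = M := by
        rw [← ENNReal.rpow_add_of_nonneg _ _ (by norm_num) (by norm_num)]
        norm_num

end SecondDifferences

section InvariantForms

variable {α β : ℤ} {L : L2 →ₗ[ℂ] ℂ}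

theorem IsInvariant.map_eq_sum_repr_smul (hL : IsInvariant α β L) (f : L2) :
    L f = ∑ n ∈ {α, β}, monomialBasis.repr f n • L (monomialLp n) := by
  rw [← coe_monomialBasis]
  -- With `8` factors the multiplier enters to the power `-1/4`, which Cauchy–Schwarz turns into
  -- the integrable singularity `‖1 - z‖ ^ (-1/2)`.
  refine ActsDiagonally.map_eq_sum_repr_smul (μ := haar) (k := 8)
    (actsDiagonally_secondDifference α β) (measurable_symbol α β) (by norm_num)
    (lintegral_enorm_one_sub_rpow_neg_lt_top (s := 1 / 2) (by norm_num) (by norm_num)).ne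
    (fun n hn => ?_) (isInvariant_iff_forall_secondDifference.1 hL) f
  simp only [Finset.mem_insert, Finset.mem_singleton, not_or] at hn
  convert lintegral_enorm_symbol_rpow_le hn.1 hn.2 (-(2 / (8 : ℕ))) using 4
  norm_num

theorem IsInvariant.exists_mem_span_eq_integral (hL : IsInvariant α β L) :
    ∃ h ∈ Submodule.span ℂ {monomialLp α, monomialLp β},
      ∀ f : L2, L f = ∫ z, f z * conj (h z) ∂haar := by
  refine ⟨∑ n ∈ {α, β}, conj (L (monomialLp n)) • monomialLp n,
    Submodule.sum_mem _ fun n hn => Submodule.smul_mem _ _ (Submodule.subset_span ?_), fun f => ?_⟩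
  · rcases Finset.mem_insert.1 hn with rfl | hn
    · exact .inl rfl
    · exact .inr (by rw [Finset.mem_singleton.1 hn]; rfl)
  · simp only [integral_mul_conj_eq_inner, hL.map_eq_sum_repr_smul f, sum_inner, inner_smul_left,
      HilbertBasis.repr_apply_apply, coe_monomialBasis, Complex.conj_conj, smul_eq_mul, mul_comm]

theorem continuous_of_eq_integral {h : L2} (hL : ∀ f : L2, L f = ∫ z, f z * conj (h z) ∂haar) :
    Continuous L := by
  simp only [integral_mul_conj_eq_inner] at hL
  rw [funext hL]
  exact continuous_const.inner continuous_id

theorem isInvariant_integralForm_of_mem_span {h : L2}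
    (hh : h ∈ Submodule.span ℂ {monomialLp α, monomialLp β}) :
    IsInvariant α β (integralForm h) := by
  obtain ⟨c₁, c₂, rfl⟩ := Submodule.mem_span_pair.1 hh
  refine isInvariant_iff_forall_secondDifference.2 fun b f => ?_
  have h_inner (n : ℤ) :
      inner ℂ (monomialLp n) (secondDifference α β b f)
        = symbol α β b n * inner ℂ (monomialLp n) f := by
    simpa only [HilbertBasis.repr_apply_apply, coe_monomialBasis] using
      actsDiagonally_secondDifference α β b f n
  calc integralForm (c₁ • monomialLp α + c₂ • monomialLp β) (secondDifference α β b f)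
      = inner ℂ (c₁ • monomialLp α + c₂ • monomialLp β) (secondDifference α β b f) :=
        integral_mul_conj_eq_inner _ _
    _ = 0 := by simp [inner_add_left, inner_smul_left, h_inner, symbol]

theorem mem_span_monomialLp_pair_iff {h : L2} :
    h ∈ Submodule.span ℂ {monomialLp α, monomialLp β} ↔
      ∃ c₁ c₂ : ℂ, ∀ᵐ z ∂haar, h z = c₁ * (z : ℂ) ^ α + c₂ * (z : ℂ) ^ β := by
  rw [Submodule.mem_span_pair]
  refine exists₂_congr fun c₁ c₂ => ?_
  have h_coeFn : (c₁ • monomialLp α + c₂ • monomialLp β : L2)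
      =ᵐ[haar] fun z => c₁ * (z : ℂ) ^ α + c₂ * (z : ℂ) ^ β := by
    filter_upwards [Lp.coeFn_add (c₁ • monomialLp α) (c₂ • monomialLp β),
      Lp.coeFn_smul c₁ (monomialLp α), Lp.coeFn_smul c₂ (monomialLp β), coeFn_monomialLp α,
      coeFn_monomialLp β] with z h_add h_smul₁ h_smul₂ hα hβ
    simp only [h_add, Pi.add_apply, h_smul₁, h_smul₂, Pi.smul_apply, hα, hβ, smul_eq_mul]
  rw [eq_comm, Lp.ext_iff]
  exact ⟨fun hh => hh.trans h_coeFn, fun hh => Filter.EventuallyEq.trans hh h_coeFn.symm⟩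

theorem isInvariant_integralForm_iff_mem_span {h : L2} :
    IsInvariant α β (integralForm h) ↔ h ∈ Submodule.span ℂ {monomialLp α, monomialLp β} := by
  refine ⟨fun h_inv => ?_, isInvariant_integralForm_of_mem_span⟩
  obtain ⟨h', h'_mem, hh'⟩ := h_inv.exists_mem_span_eq_integral
  have h_eq : h = h' := ext_inner_right ℂ fun f => by
    rw [← integral_mul_conj_eq_inner, ← integral_mul_conj_eq_inner, ← hh' f]
    rfl
  rwa [h_eq]

theorem IsTranslationInvariant.isInvariant (hL : IsTranslationInvariant L) :
    IsInvariant 0 0 L := by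
  refine isInvariant_iff_forall_secondDifference.2 fun b f => ?_
  simp only [secondDifference, map_add, map_sub, map_smul, hL b f, hL b⁻¹ f, smul_eq_mul,
    add_zero, neg_zero, zpow_zero]
  ring

theorem IsTranslationInvariant.map_eq_mul_integral (hL : IsTranslationInvariant L) (f : L2) :
    L f = L (monomialLp 0) * ∫ z, f z ∂haar := by
  simp [hL.isInvariant.map_eq_sum_repr_smul f, monomialBasis_repr, mul_comm]

end InvariantForms

end CircleGroup

theorem mainTheorem4 (α β : ℤ) (L : CircleGroup.L2 →ₗ[ℂ] ℂ) :
    (CircleGroup.IsInvariant α β L →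
      Continuous L ∧
        ∃ h : CircleGroup.L2, ∀ f : CircleGroup.L2,
          L f = ∫ z, f z * conj (h z) ∂CircleGroup.haar) ∧
    (∀ h : CircleGroup.L2,
      CircleGroup.IsInvariant α β (CircleGroup.integralForm h) ↔
        ∃ c₁ c₂ : ℂ, ∀ᵐ z ∂CircleGroup.haar,
          h z = c₁ * (z : ℂ) ^ α + c₂ * (z : ℂ) ^ β) ∧
    (CircleGroup.IsTranslationInvariant L →
      ∃ c : ℂ, ∀ f : CircleGroup.L2, L f = c * ∫ z, f z ∂CircleGroup.haar) := by
  refine ⟨fun hL => ?_, fun h => ?_, fun hL => ⟨_, hL.map_eq_mul_integral⟩⟩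
  · obtain ⟨h, -, hLh⟩ := hL.exists_mem_span_eq_integral
    exact ⟨CircleGroup.continuous_of_eq_integral hLh, h, hLh⟩
  · exact CircleGroup.isInvariant_integralForm_iff_mem_span.trans
      CircleGroup.mem_span_monomialLp_pair_iff
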